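/- All rings are commutative with $1$. Let $R$ be a ring and $S\subseteq R$ a multiplicative subset ($1\in S$ and $SS\subseteq S$). A sequence of $R$-modules $M\xrightarrow{f}N\xrightarrow{g}L$ is called $S$-exact (at $N$) if there is $s\in S$ with $s\,\mathrm{Ker}(g)\subseteq \mathrm{Im}(f)$ and $s\,\mathrm{Im}(f)\subseteq\mathrm{Ker}(g)$; a longer sequence is $S$-exact if it is $S$-exact at each of its inner terms. An $R$-module $F$ is $S$-flat if for every $S$-exact sequence $0\to M\to N\to L\to 0$ of $R$-modules the induced sequence $0\to M\otimes_R F\to N\otimes_R F\to L\otimes_R F\to 0$ is $S$-exact. The $S$-flat dimension of an $R$-module $M$ is the least $n\geq 0$ for which there is an $S$-exact sequence $0\to F_n\to\cdots\to F_1\to F_0\to M\to 0$ with all $F_i$ $S$-flat (and $\infty$ if there is none), and $S\text{-w.gl.dim}(R)$ is the supremum of the $S$-flat dimensions of all $R$-modules. The flat dimension of $M$ and $\mathrm{w.gl.dim}(R)$ are defined in the same way with exact sequences and flat modules. Let $A$ be a commutative ring with $\mathrm{w.gl.dim}(A)=1$, let $T=A\times A$, $s=(1,0)\in T$ and $R=T[x]/\langle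 sx,\,x^2\rangle$, and let $S=\{1,s\}\subseteq R$ (a multiplicative subset, since $s^2=s$). Then $S\text{-w.gl.dim}(R)=1$, while $\mathrm{w.gl.dim}(R)=\infty$. -/

import Mathlib

open scoped TensorProduct Polynomial

universe u

section SHomological

variable {R : Type u} [CommRing R] (S : Submonoid R)

/-- The sequence `M → N → L` is `S`-exact (at `N`): a single `s ∈ S` satisfies
`s Ker(g) ⊆ Im(f)` and `s Im(f) ⊆ Ker(g)`. -/
def SExact {M N L : Type u} [AddCommGroup M] [Module R M] [AddCommGroup N] [Module R N]
    [AddCommGroup L] [Module R L] (f : M →ₗ[R] N) (g : N →ₗ[R] L) : Prop :=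
  ∃ s ∈ S, (∀ x ∈ LinearMap.ker g, s • x ∈ LinearMap.range f) ∧
    (∀ x ∈ LinearMap.range f, s • x ∈ LinearMap.ker g)

/-- The sequence `0 → M → N → L → 0` is `S`-exact at `M`, `N` and `L`. -/
def ShortSExact {M N L : Type u} [AddCommGroup M] [Module R M] [AddCommGroup N] [Module R N]
    [AddCommGroup L] [Module R L] (f : M →ₗ[R] N) (g : N →ₗ[R] L) : Prop :=
  SExact S (0 : PUnit.{u + 1} →ₗ[R] M) f ∧ SExact S f g ∧ SExact S g (0 : L →ₗ[R] PUnit.{u + 1})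

/-- `F` is `S`-flat: tensoring with `F` preserves short `S`-exact sequences. -/
def SFlat (F : Type u) [AddCommGroup F] [Module R F] : Prop :=
  ∀ (M N L : Type u) [AddCommGroup M] [Module R M] [AddCommGroup N] [Module R N]
    [AddCommGroup L] [Module R L] (f : M →ₗ[R] N) (g : N →ₗ[R] L),
    ShortSExact S f g → ShortSExact S (f.rTensor F) (g.rTensor F)

/-- There is an `S`-exact sequence `0 → F n → ⋯ → F 1 → F 0 → M → 0` with every `F i` `S`-flat.
The sequence is written as an infinite one whose terms beyond `F n` are zero. -/
def HasSFlatSResolution (M : Type u) [AddCommGroup M] [Module R M] (n : ℕ) : Prop :=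
  ∃ (F : ℕ → ModuleCat.{u} R) (d : ∀ i, F (i + 1) →ₗ[R] F i) (ε : F 0 →ₗ[R] M),
    (∀ i ≤ n, SFlat S (F i)) ∧ (∀ i, n < i → Subsingleton (F i)) ∧
    SExact S ε (0 : M →ₗ[R] PUnit.{u + 1}) ∧ SExact S (d 0) ε ∧
    ∀ i, SExact S (d (i + 1)) (d i)

/-- `S`-fd: the length of the shortest `S`-flat `S`-resolution (`⊤` if there is none). -/
noncomputable def sFlatDim (M : Type u) [AddCommGroup M] [Module R M] : ℕ∞ :=
  ⨅ (n : ℕ) (_ : HasSFlatSResolution S M n), (n : ℕ∞)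

/-- `S`-w.gl.dim: the supremum of the `S`-flat dimensions of all `R`-modules. -/
noncomputable def sWeakGlobalDim : ℕ∞ :=
  ⨆ M : ModuleCat.{u} R, sFlatDim S M

end SHomological

section Homological

variable (R : Type u) [CommRing R]

/-- There is an exact sequence `0 → F n → ⋯ → F 1 → F 0 → M → 0` with every `F i` flat.
The sequence is written as an infinite one whose terms beyond `F n` are zero. -/
def HasFlatResolution (M : Type u) [AddCommGroup M] [Module R M] (n : ℕ) : Prop :=
  ∃ (F : ℕ → ModuleCat.{u} R) (d : ∀ i, F (i + 1) →ₗ[R] F i) (ε : F 0 →ₗ[R] M),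
    (∀ i ≤ n, Module.Flat R (F i)) ∧ (∀ i, n < i → Subsingleton (F i)) ∧
    Function.Surjective ε ∧ Function.Exact (d 0) ε ∧
    ∀ i, Function.Exact (d (i + 1)) (d i)

/-- fd: the length of the shortest flat resolution (`⊤` if there is no finite one). -/
noncomputable def flatDim (M : Type u) [AddCommGroup M] [Module R M] : ℕ∞ :=
  ⨅ (n : ℕ) (_ : HasFlatResolution R M n), (n : ℕ∞)

/-- w.gl.dim: the supremum of the flat dimensions of all `R`-modules. -/
noncomputable def weakGlobalDim : ℕ∞ :=
  ⨆ M : ModuleCat.{u} R, flatDim R M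

end Homological

section Construction

variable (A : Type u) [CommRing A]

/-- The ring `R = T[x] / ⟨s x, x²⟩` with `T = A × A` and `s = (1, 0)`. -/
abbrev TruncatedRing : Type u :=
  (A × A)[X] ⧸
    Ideal.span {Polynomial.C ((1, 0) : A × A) * Polynomial.X, (Polynomial.X ^ 2 : (A × A)[X])}

/-- The image in `R` of `s = (1, 0) ∈ T`. -/
noncomputable def truncatedS : TruncatedRing A :=
  Ideal.Quotient.mk _ (Polynomial.C ((1, 0) : A × A))

theorem truncatedS_mul_self : truncatedS A * truncatedS A = truncatedS A := by
  unfold truncatedS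
  rw [← map_mul, ← map_mul]
  simp

/-- The multiplicative subset `S = {1, s}` of `R`. -/
noncomputable def truncatedSubmonoid : Submonoid (TruncatedRing A) where
  carrier := {1, truncatedS A}
  one_mem' := Or.inl rfl
  mul_mem' := by
    rintro a b (rfl | rfl) (rfl | rfl)
    · left; simp
    · right; simp
    · right; simp
    · right; exact truncatedS_mul_self A

end Construction

/-! ### Flatness and `S`-exactness -/

section SExactLemmas

variable {R : Type u} [CommRing R] {S : Submonoid R}
  {M N L : Type u} [AddCommGroup M] [Module R M] [AddCommGroup N] [Module R N]
  [AddCommGroup L] [Module R L]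

/-! The idempotent `s` splits `R` as `A × A[x]/(x²)`, and up to multiplication by `s` only the
factor `A` is visible. Since `A` is flat over `R`, a flat `A`-resolution of `sM` is an `S`-flat
`S`-resolution of `M` (`HasFlatResolution.hasSFlatSResolution`), so the `S`-dimension is at most 1.
Were it 0, every `A`-module would be flat (`flat_of_hasSFlatSResolution_zero`), contradicting
`w.gl.dim(A) = 1`.

The ordinary dimension is infinite because of the factor `A[x]/(x²)`. The annihilator of `x` is `(s,
x)`, so by the equational criterion every element of a flat module `M` killed by `x` lies in `sM +
xM`. This property passes to modules with a finite flat resolution, but fails for `R/(s, x)`. -/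

theorem sExact_zero_left_iff {P : Type u} [AddCommGroup P] [Module R P] {f : M →ₗ[R] N} :
    SExact S (0 : P →ₗ[R] M) f ↔ ∃ s ∈ S, ∀ x, f x = 0 → s • x = 0 := by
  simp [SExact, LinearMap.range_zero]

theorem sExact_zero_right_iff {P : Type u} [AddCommGroup P] [Module R P] {f : M →ₗ[R] N} :
    SExact S f (0 : N →ₗ[R] P) ↔ ∃ s ∈ S, ∀ x, s • x ∈ LinearMap.range f := by
  simp [SExact]

theorem Function.Exact.sExact {f : M →ₗ[R] N} {g : N →ₗ[R] L} (h : Function.Exact f g) :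
    SExact S f g :=
  ⟨1, S.one_mem, fun x hx ↦ by simpa using (h x).1 hx, fun x hx ↦ by simpa using (h x).2 hx⟩

/-- Tensoring with a flat module preserves `S`-exactness. -/
theorem SExact.rTensor {f : M →ₗ[R] N} {g : N →ₗ[R] L} (h : SExact S f g)
    (F : Type u) [AddCommGroup F] [Module R F] [Module.Flat R F] :
    SExact S (f.rTensor F) (g.rTensor F) := by
  obtain ⟨s, hs, h₁, h₂⟩ := h
  refine ⟨s, hs, fun x hx ↦ ?_, ?_⟩
  -- By flatness, the kernel of `g ⊗ F` is the image of `ker g ⊗ F`, so the same `s` works on pure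
  -- tensors.
  · obtain ⟨y, rfl⟩ :=
      (Module.Flat.rTensor_exact F (LinearMap.exact_subtype_ker_map g) x).1 hx
    clear hx
    induction y with
    | zero => simp
    | add a b ha hb =>
      rw [map_add, smul_add]
      exact add_mem ha hb
    | tmul k c =>
      obtain ⟨m, hm⟩ := h₁ k k.2
      exact ⟨m ⊗ₜ c, by simp [hm, TensorProduct.smul_tmul']⟩
  · rintro _ ⟨y, rfl⟩
    have h0 : s • (g ∘ₗ f) = 0 := by
      ext m
      simpa using h₂ (f m) ⟨m, rfl⟩
    have h1 : s • (g ∘ₗ f).rTensor F = 0 := by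
      rw [← LinearMap.rTensor_smul, h0, LinearMap.rTensor_zero]
    rw [LinearMap.rTensor_comp] at h1
    simpa using LinearMap.congr_fun h1 y

/-- Flat modules are `S`-flat. -/
theorem Module.Flat.sFlat (F : Type u) [AddCommGroup F] [Module R F] [Module.Flat R F] :
    SFlat S F := by
  intro M N L _ _ _ _ _ _ f g ⟨h₁, h₂, h₃⟩
  refine ⟨?_, h₂.rTensor F, ?_⟩
  · have := h₁.rTensor F
    rw [LinearMap.rTensor_zero, sExact_zero_left_iff] at this
    exact sExact_zero_left_iff.2 this
  · have := h₃.rTensor F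
    rw [LinearMap.rTensor_zero, sExact_zero_right_iff] at this
    exact sExact_zero_right_iff.2 this

end SExactLemmas

/-! ### Dimensions as infima of resolution lengths -/

section DimensionLemmas

theorem flatDim_le {R : Type u} [CommRing R] {M : Type u} [AddCommGroup M] [Module R M] {n : ℕ}
    (h : HasFlatResolution R M n) : flatDim R M ≤ n :=
  iInf₂_le n h

theorem sFlatDim_le {R : Type u} [CommRing R] {S : Submonoid R} {M : Type u} [AddCommGroup M]
    [Module R M] {n : ℕ} (h : HasSFlatSResolution S M n) : sFlatDim S M ≤ n :=
  iInf₂_le n h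

theorem exists_hasFlatResolution_of_flatDim_le {R : Type u} [CommRing R] {M : Type u}
    [AddCommGroup M] [Module R M] {n : ℕ} (h : flatDim R M ≤ n) :
    ∃ k ≤ n, HasFlatResolution R M k := by
  by_contra! hc
  have : ((n + 1 : ℕ) : ℕ∞) ≤ flatDim R M :=
    le_iInf₂ fun k hk ↦ Nat.cast_le.2 (by by_contra hlt; exact hc k (by omega) hk)
  have := Nat.cast_le.1 (this.trans h)
  omega

theorem exists_hasSFlatSResolution_of_sFlatDim_le {R : Type u} [CommRing R] {S : Submonoid R}
    {M : Type u} [AddCommGroup M] [Module R M] {n : ℕ} (h : sFlatDim S M ≤ n) :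
    ∃ k ≤ n, HasSFlatSResolution S M k := by
  by_contra! hc
  have : ((n + 1 : ℕ) : ℕ∞) ≤ sFlatDim S M :=
    le_iInf₂ fun k hk ↦ Nat.cast_le.2 (by by_contra hlt; exact hc k (by omega) hk)
  have := Nat.cast_le.1 (this.trans h)
  omega

theorem hasFlatResolution_zero {R : Type u} [CommRing R] (M : Type u) [AddCommGroup M]
    [Module R M] [Module.Flat R M] : HasFlatResolution R M 0 := by
  refine ⟨fun i ↦ Nat.casesOn i (ModuleCat.of R M) fun _ ↦ ModuleCat.of R PUnit, fun _ ↦ 0,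
    LinearMap.id, ?_, ?_, Function.surjective_id, ?_, ?_⟩
  · rintro i hi
    obtain rfl : i = 0 := by omega
    assumption
  · rintro (_ | i) hi
    · omega
    · exact inferInstanceAs (Subsingleton PUnit)
  · intro x
    change x = 0 ↔ _
    constructor
    · rintro rfl; exact ⟨0, rfl⟩
    · rintro ⟨_, rfl⟩; rfl
  · intro i x
    exact ⟨fun _ ↦ ⟨0, rfl⟩, fun _ ↦ rfl⟩

end DimensionLemmas

/-! ### Comparing `R` with the factor cut out by the idempotent `σ 1` -/

section IdempotentFactor

variable {R A : Type u} [CommRing R] [CommRing A] [Algebra R A] {σ : A →ₙ+* R}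

/-- A ring factor `A` of `R`, embedded by a non-unital section `σ`, is flat over `R`. -/
theorem flat_of_section (hσ : ∀ a, algebraMap R A (σ a) = a)
    (hσ' : ∀ r, σ (algebraMap R A r) = σ 1 * r) : Module.Flat R A := by
  let i : A →ₗ[R] R :=
    { toFun := σ
      map_add' := map_add σ
      map_smul' := fun r a ↦ by
        rw [Algebra.smul_def, map_mul, hσ', RingHom.id_apply, smul_eq_mul, mul_assoc, mul_left_comm,
          ← map_mul, one_mul] }
  exact Module.Flat.of_retract (M := R) i (Algebra.linearMap R A) (LinearMap.ext hσ)

/-- An `A`-module with an `S`-flat `S`-resolution of length `0` over `R` is flat over `A`. -/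
theorem flat_of_hasSFlatSResolution_zero {S : Submonoid R}
    (hσ : ∀ a, algebraMap R A (σ a) = a)
    (hσ' : ∀ r, σ (algebraMap R A r) = σ 1 * r)
    (hS : ∀ r ∈ S, algebraMap R A r = 1)
    {N : Type u} [AddCommGroup N] [Module R N] [Module A N] [IsScalarTower R A N]
    (h : HasSFlatSResolution S N 0) : Module.Flat A N := by
  obtain ⟨F, d, ε, hF, hF', hε, hd, -⟩ := h
  have act : ∀ {P : Type u} [AddCommGroup P] [Module R P] [Module A P] [IsScalarTower R A P],
      ∀ r ∈ S, ∀ x : P, r • x = x := by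
    intro P _ _ _ _ r hr x
    rw [← algebraMap_smul A r x, hS r hr, one_smul]
  have hsurj : Function.Surjective ε := by
    obtain ⟨s, hs, hs'⟩ := sExact_zero_right_iff.1 hε
    intro x
    obtain ⟨y, hy⟩ := hs' x
    exact ⟨y, by rw [hy, act s hs]⟩
  -- As `F 1 = 0`, some `s ∈ S` kills the kernel of `ε`; then so does `σ 1 = σ 1 * s`.
  have hker : ∀ x, ε x = 0 → σ 1 • x = 0 := by
    intro x hx
    obtain ⟨s, hs, hs', -⟩ := hd
    have := hF' 1 one_pos
    obtain ⟨y, hy⟩ := hs' x hx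
    have hy0 : y = 0 := Subsingleton.elim _ _
    rw [hy0, map_zero] at hy
    have : σ 1 * s = σ 1 := by rw [← hσ', hS s hs]
    rw [← this, mul_smul, ← hy, smul_zero]
  have hdiff : ∀ x y, ε x = ε y → σ 1 • x = σ 1 • y := by
    intro x y hxy
    rw [← sub_eq_zero, ← smul_sub]
    exact hker _ (by rw [map_sub, hxy, sub_self])
  let p := Function.surjInv hsurj
  have hp : ∀ n, ε (p n) = n := Function.surjInv_eq hsurj
  -- Two preimages under `ε` differ by an element killed by `σ 1`, so this does not depend on the
  -- choice and is linear. It splits `ε` because `σ 1` acts as the identity on `N`.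
  let τ : N →ₗ[R] F 0 :=
    { toFun := fun n ↦ σ 1 • p n
      map_add' := fun m n ↦ by
        rw [← smul_add]
        exact hdiff _ _ (by simp [hp])
      map_smul' := fun r n ↦ by
        rw [RingHom.id_apply, smul_comm r]
        exact hdiff _ _ (by simp [hp]) }
  have hτ : ε ∘ₗ τ = LinearMap.id := by
    ext n
    change ε (σ 1 • p n) = n
    rw [map_smul, hp, ← algebraMap_smul A, hσ, one_smul]
  refine Module.Flat.iff_rTensor_injectiveₛ.2 fun P _ _ I ↦ ?_
  let _ : AddCommGroup P := Module.addCommMonoidToAddCommGroup A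
  let _ : Module R P := Module.compHom P (algebraMap R A)
  have : IsScalarTower R A P := IsScalarTower.of_algebraMap_smul fun _ _ ↦ rfl
  -- Since `R → A` is surjective, tensor products over `A` and over `R` agree.
  have hcompat : TensorProduct.CompatibleSMul R A I N :=
    ⟨fun a p n ↦ by
      rw [← hσ a, algebraMap_smul, algebraMap_smul, TensorProduct.smul_tmul]⟩
  let f : I →ₗ[R] P := I.subtype.restrictScalars R
  have hf : Function.Injective f := I.injective_subtype
  have hshort : ShortSExact S f (LinearMap.range f).mkQ := by
    refine ⟨sExact_zero_left_iff.2 ⟨1, S.one_mem, fun x hx ↦ ?_⟩,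
      (LinearMap.exact_map_mkQ_range f).sExact,
      sExact_zero_right_iff.2 ⟨1, S.one_mem, fun x ↦ ?_⟩⟩
    · rw [(map_eq_zero_iff f hf).1 hx, smul_zero]
    · rw [one_smul]
      exact Submodule.mkQ_surjective _ x
  -- The kernel of `I ⊗ F 0 → P ⊗ F 0` is killed by some `s ∈ S`, which acts as 1 since `I` is an
  -- `A`-module. So this map is injective, and `I ⊗ N → P ⊗ N` inherits injectivity as a retract.
  obtain ⟨s, hs, hs'⟩ := sExact_zero_left_iff.1 (hF 0 le_rfl _ _ _ f _ hshort).1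
  rw [injective_iff_map_eq_zero]
  intro z hz
  have : TensorProduct.CompatibleSMul R A P N :=
    ⟨fun a p n ↦ by
      rw [← hσ a, algebraMap_smul, algebraMap_smul, TensorProduct.smul_tmul]⟩
  let e := TensorProduct.equivOfCompatibleSMul R A R I N
  have he : ∀ z, f.rTensor N (e z) =
      TensorProduct.mapOfCompatibleSMul R A R P N (I.subtype.rTensor N z) := by
    intro z
    induction z with
    | zero => simp
    | add a b ha hb => rw [map_add, map_add, map_add, map_add, ha, hb]
    | tmul a b => rfl
  have hez := he z
  rw [hz, map_zero] at hez
  have hw : f.rTensor (F 0) (τ.lTensor I (e z)) = 0 := by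
    rw [← LinearMap.comp_apply, LinearMap.rTensor_comp_lTensor, ← LinearMap.lTensor_comp_rTensor,
      LinearMap.comp_apply, hez, map_zero]
  have hw' := hs' _ hw
  rw [act s hs] at hw'
  have hret : e z = ε.lTensor I (τ.lTensor I (e z)) := by
    rw [← LinearMap.comp_apply, ← LinearMap.lTensor_comp, hτ, LinearMap.lTensor_id,
      LinearMap.id_apply]
  rw [hw', map_zero] at hret
  exact e.map_eq_zero_iff.1 hret

/-- Regarding a flat resolution over the factor `A` as an `S`-flat `S`-resolution over `R`. -/
theorem HasFlatResolution.hasSFlatSResolution {S : Submonoid R}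
    (hσ : ∀ a, algebraMap R A (σ a) = a)
    (hσ' : ∀ r, σ (algebraMap R A r) = σ 1 * r)
    {N : Type u} [AddCommGroup N] [Module R N] [Module A N] [IsScalarTower R A N]
    {n : ℕ} (h : HasFlatResolution A N n)
    {M : Type u} [AddCommGroup M] [Module R M] (i : N →ₗ[R] M) (hi : Function.Injective i)
    {s : R} (hs : s ∈ S) (his : ∀ m, s • m ∈ LinearMap.range i) :
    HasSFlatSResolution S M n := by
  obtain ⟨F, d, ε, hF, hF', hε, hd, hd'⟩ := h
  have := flat_of_section hσ hσ'
  let (i : ℕ) : Module R (F i) := Module.compHom (F i) (algebraMap R A)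
  have (i : ℕ) : IsScalarTower R A (F i) := IsScalarTower.of_algebraMap_smul fun _ _ ↦ rfl
  refine ⟨fun i ↦ ModuleCat.of R (F i), fun i ↦ (d i).restrictScalars R,
    i ∘ₗ ε.restrictScalars R, ?_, hF', ?_, ?_, ?_⟩
  · intro j hj
    have := hF j hj
    have : Module.Flat R (F j) := Module.Flat.trans R A (F j)
    exact Module.Flat.sFlat (F j)
  -- The augmentation reaches only the image of `i`, which contains `sM`.
  · refine sExact_zero_right_iff.2 ⟨s, hs, fun m ↦ ?_⟩
    obtain ⟨x, hx⟩ := his m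
    obtain ⟨y, rfl⟩ := hε x
    exact ⟨y, hx⟩
  · refine Function.Exact.sExact fun x ↦ ?_
    rw [← show _ ↔ x ∈ Set.range ((d 0).restrictScalars R) from hd x]
    exact map_eq_zero_iff i hi
  · exact fun j ↦ Function.Exact.sExact (hd' j)

/-- For every `R`-module `M`, the submodule `σ 1 • M` is naturally an `A`-module. -/
theorem exists_factor_module
    (hσ' : ∀ r, σ (algebraMap R A r) = σ 1 * r) (M : Type u) [AddCommGroup M] [Module R M] :
    ∃ (N : Submodule R M) (_ : Module A N), IsScalarTower R A N ∧ ∀ m : M, σ 1 • m ∈ N := by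
  let N : Submodule R M := LinearMap.range (LinearMap.lsmul R M (σ 1))
  -- Idempotence of `σ 1` makes the action through the non-unital `σ` unital on `N`.
  have hN : ∀ x : N, σ 1 • x = x := by
    rintro ⟨_, y, rfl⟩
    ext
    simp [smul_smul, ← map_mul]
  let _ : SMul A N := ⟨fun a x ↦ σ a • x⟩
  refine ⟨N,
    { one_smul := hN
      mul_smul := fun a b x ↦ ?_
      smul_zero := fun a ↦ smul_zero (σ a)
      smul_add := fun a ↦ smul_add (σ a)
      add_smul := fun a b x ↦ ?_
      zero_smul := fun x ↦ ?_ }, ⟨fun r a x ↦ ?_⟩, fun m ↦ ⟨m, rfl⟩⟩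
  · change σ (a * b) • x = σ a • σ b • x
    rw [map_mul, mul_smul]
  · change σ (a + b) • x = σ a • x + σ b • x
    rw [map_add, add_smul]
  · change σ 0 • x = 0
    rw [map_zero, zero_smul]
  · change σ (r • a) • x = r • σ a • x
    rw [Algebra.smul_def, map_mul, hσ', mul_smul, mul_smul, smul_comm, hN]

/-- The `S`-weak global dimension of `R` is the weak global dimension of its localization `A` at an
idempotent. -/
theorem sWeakGlobalDim_eq_weakGlobalDim {S : Submonoid R}
    (hσ : ∀ a, algebraMap R A (σ a) = a)
    (hσ' : ∀ r, σ (algebraMap R A r) = σ 1 * r)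
    (hS : ∀ r ∈ S, algebraMap R A r = 1) (h1 : σ 1 ∈ S) (hA : weakGlobalDim A = 1) :
    sWeakGlobalDim S = 1 := by
  apply le_antisymm
  · refine iSup_le fun M ↦ ?_
    obtain ⟨N, _, _, hN⟩ := exists_factor_module hσ' M
    have hle : flatDim A N ≤ (1 : ℕ) := by
      rw [Nat.cast_one, ← hA]
      exact le_iSup (fun M : ModuleCat.{u} A ↦ flatDim A M) (ModuleCat.of A N)
    obtain ⟨k, hk, hres⟩ := exists_hasFlatResolution_of_flatDim_le hle
    refine (sFlatDim_le (hres.hasSFlatSResolution hσ hσ' N.subtype N.injective_subtype h1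
      (by simpa using hN))).trans ?_
    exact_mod_cast hk
  · rw [Order.one_le_iff_ne_zero]
    intro h0
    have : weakGlobalDim A ≤ 0 := by
      refine iSup_le fun N ↦ ?_
      let : Module R N := Module.compHom N (algebraMap R A)
      have : IsScalarTower R A N := IsScalarTower.of_algebraMap_smul fun _ _ ↦ rfl
      have hle : sFlatDim S N ≤ (0 : ℕ) := by
        rw [Nat.cast_zero, ← h0]
        exact le_iSup (fun M : ModuleCat.{u} R ↦ sFlatDim S M) (ModuleCat.of R N)
      obtain ⟨k, hk, hres⟩ := exists_hasSFlatSResolution_of_sFlatDim_le hle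
      obtain rfl : k = 0 := by omega
      have := flat_of_hasSFlatSResolution_zero hσ hσ' hS hres
      simpa using flatDim_le (hasFlatResolution_zero (R := A) N)
    rw [hA] at this
    exact absurd this (by simp)

end IdempotentFactor

/-! ### An obstruction to finite flat dimension -/

section InfiniteDimension

variable {R : Type u} [CommRing R] {e y : R}

/-- If the annihilator of `y` in `R` lies in `(e, y)`, the same holds for the elements of any flat
module. -/
theorem Module.Flat.exists_smul_add_smul_of_smul_eq_zero
    (hann : ∀ r, y * r = 0 → ∃ a b, r = e * a + y * b)
    {F : Type u} [AddCommGroup F] [Module R F] [Module.Flat R F] {x : F} (hx : y • x = 0) :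
    ∃ a b : F, x = e • a + y • b := by
  -- Equational criterion: `x = ∑ a_j z_j` with every `y a_j = 0`.
  obtain ⟨k, a, z, hxz, ha⟩ := Module.Flat.isTrivialRelation_of_sum_smul_eq_zero
    (ι := Unit) (f := fun _ ↦ y) (x := fun _ ↦ x) (by simpa using hx)
  choose b c hbc using fun j ↦ hann (a () j) (by simpa using ha j)
  refine ⟨∑ j, b j • z j, ∑ j, c j • z j, ?_⟩
  rw [show x = _ from hxz (), Finset.smul_sum, Finset.smul_sum, ← Finset.sum_add_distrib]
  exact Finset.sum_congr rfl fun j _ ↦ by rw [hbc, add_smul, mul_smul, mul_smul]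

/-- If every element killed by `y` lies in `eK + yK` for the kernel `K` and for the source of a
surjection, then the same holds for the target. -/
theorem exists_smul_add_smul_of_surjective (he : e * e = e) (hey : e * y = 0)
    {F M : Type u} [AddCommGroup F] [Module R F] [AddCommGroup M] [Module R M]
    (hF : ∀ x : F, y • x = 0 → ∃ a b : F, x = e • a + y • b)
    {f : F →ₗ[R] M}
    (hK : ∀ x : F, f x = 0 → y • x = 0 → ∃ a b : F, f a = 0 ∧ f b = 0 ∧ x = e • a + y • b)
    (hyy : y * y = 0) {m : M} (hm : m ∈ LinearMap.range f) (hym : y • m = 0) :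
    ∃ a b : F, m = e • f a + y • f b := by
  obtain ⟨x, rfl⟩ := hm
  -- Here `y x` lies in the kernel and is killed by `y`, so `y x = e a + y b`. Multiplying by `e`
  -- gives `e a = 0`, so `y` kills `x - b`, another lift of `m`.
  obtain ⟨a, b, ha, hb, hab⟩ := hK (y • x) (by rw [map_smul, hym])
    (by rw [smul_smul, hyy, zero_smul])
  have hea : e • a = 0 := by
    have := congrArg (e • ·) hab
    simpa [smul_smul, hey, he] using this.symm
  obtain ⟨c, d, hcd⟩ := hF (x - b) (by rw [smul_sub, hab, hea, zero_add, sub_self])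
  refine ⟨c, d, ?_⟩
  rw [← map_smul, ← map_smul, ← map_add, ← hcd, map_sub, hb, sub_zero]

/-- A module of finite flat dimension has no elements killed by `y` outside `eM + yM`. -/
theorem HasFlatResolution.exists_smul_add_smul_of_smul_eq_zero
    (he : e * e = e) (hey : e * y = 0) (hyy : y * y = 0)
    (hann : ∀ r, y * r = 0 → ∃ a b, r = e * a + y * b)
    {M : Type u} [AddCommGroup M] [Module R M] {n : ℕ} (h : HasFlatResolution R M n)
    {m : M} (hm : y • m = 0) : ∃ a b : M, m = e • a + y • b := by
  obtain ⟨F, d, ε, hF, hF', hε, hd, hd'⟩ := h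
  have hflat : ∀ i, ∀ x : F i, y • x = 0 → ∃ a b : F i, x = e • a + y • b := by
    intro i x hx
    rcases le_or_gt i n with hi | hi
    · have := hF i hi
      exact Module.Flat.exists_smul_add_smul_of_smul_eq_zero hann hx
    · have := hF' i hi
      exact ⟨0, 0, Subsingleton.elim _ _⟩
  -- Descending induction on `i`, started where `F (i + 1) = 0`.
  have hker : ∀ k i, n < i + k → ∀ x : F (i + 1), d i x = 0 → y • x = 0 →
      ∃ a b : F (i + 1), d i a = 0 ∧ d i b = 0 ∧ x = e • a + y • b := by
    intro k
    induction k with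
    | zero =>
      intro i hi x _ _
      have := hF' (i + 1) (by omega)
      exact ⟨0, 0, by simp, by simp, Subsingleton.elim _ _⟩
    | succ k ih =>
      intro i hi x hx hyx
      obtain ⟨a, b, hab⟩ := exists_smul_add_smul_of_surjective he hey (hflat (i + 2))
        (ih (i + 1) (by omega)) hyy ((hd' i x).1 hx) hyx
      exact ⟨_, _, (hd' i).apply_apply_eq_zero a, (hd' i).apply_apply_eq_zero b, hab⟩
  have hker₀ : ∀ x : F 0, ε x = 0 → y • x = 0 →
      ∃ a b : F 0, ε a = 0 ∧ ε b = 0 ∧ x = e • a + y • b := by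
    intro x hx hyx
    obtain ⟨a, b, hab⟩ := exists_smul_add_smul_of_surjective he hey (hflat 1)
      (hker (n + 1) 0 (by omega)) hyy ((hd x).1 hx) hyx
    exact ⟨_, _, hd.apply_apply_eq_zero a, hd.apply_apply_eq_zero b, hab⟩
  obtain ⟨a, b, hab⟩ := exists_smul_add_smul_of_surjective he hey (hflat 0) hker₀ hyy
    (hε m) hm
  exact ⟨_, _, hab⟩

/-- In `M = R/(e, y)` the class of 1 is nonzero and killed by `y`, while `eM + yM = 0`. -/
theorem weakGlobalDim_eq_top (he : e * e = e) (hey : e * y = 0) (hyy : y * y = 0)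
    (hann : ∀ r, y * r = 0 → ∃ a b, r = e * a + y * b) (hne : Ideal.span {e, y} ≠ ⊤) :
    weakGlobalDim R = ⊤ := by
  let M := R ⧸ Ideal.span {e, y}
  have hzero : ∀ r ∈ ({e, y} : Set R), ∀ x : M, r • x = 0 := by
    intro r hr x
    obtain ⟨t, rfl⟩ := Ideal.Quotient.mk_surjective x
    rw [Algebra.smul_def, Ideal.Quotient.algebraMap_eq,
      Ideal.Quotient.eq_zero_iff_mem.2 (Ideal.subset_span hr), zero_mul]
  have hM : flatDim R M = ⊤ := by
    refine iInf₂_eq_top.2 fun n h ↦ ?_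
    obtain ⟨a, b, hab⟩ := h.exists_smul_add_smul_of_smul_eq_zero he hey hyy hann
      (hzero y (by simp) 1)
    rw [hzero e (by simp), hzero y (by simp), add_zero] at hab
    exact absurd (Ideal.Quotient.zero_eq_one_iff.1 hab.symm) hne
  exact top_le_iff.1 (hM ▸ le_iSup (fun M : ModuleCat.{u} R ↦ flatDim R M) (ModuleCat.of R M))

end InfiniteDimension

/-! ### The ring `T[x]/(sx, x²)` -/

section TruncatedRing

variable (A : Type u) [CommRing A]

/-- Evaluation at `x = 0` as a map `R → A × A`. -/
noncomputable def truncatedEval : TruncatedRing A →+* A × A :=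
  Ideal.Quotient.lift _ (Polynomial.evalRingHom 0) fun p hp ↦ by
    have : Ideal.span {Polynomial.C ((1, 0) : A × A) * Polynomial.X,
        (Polynomial.X ^ 2 : (A × A)[X])} ≤ RingHom.ker (Polynomial.evalRingHom (0 : A × A)) := by
      rw [Ideal.span_le]
      rintro _ (rfl | rfl) <;> simp [RingHom.mem_ker]
    exact this hp

theorem truncatedEval_mk (p : (A × A)[X]) :
    truncatedEval A (Ideal.Quotient.mk _ p) = p.eval 0 := rfl

/-- The class of the variable `x` in `R`. -/
noncomputable def truncatedX : TruncatedRing A :=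
  Ideal.Quotient.mk _ Polynomial.X

theorem truncatedS_mul_truncatedX : truncatedS A * truncatedX A = 0 := by
  rw [truncatedS, truncatedX, ← map_mul, Ideal.Quotient.eq_zero_iff_mem]
  exact Ideal.subset_span (by simp)

theorem truncatedX_mul_self : truncatedX A * truncatedX A = 0 := by
  rw [truncatedX, ← map_mul, ← sq, Ideal.Quotient.eq_zero_iff_mem]
  exact Ideal.subset_span (by simp)

/-- A lift `p` of `r` satisfies `X p = a s X + b X²` in `T[X]`; cancel the regular element `X`. -/
theorem exists_of_truncatedX_mul_eq_zero (r : TruncatedRing A) (h : truncatedX A * r = 0) :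
    ∃ a b, r = truncatedS A * a + truncatedX A * b := by
  obtain ⟨p, rfl⟩ := Ideal.Quotient.mk_surjective r
  rw [truncatedX, ← map_mul, Ideal.Quotient.eq_zero_iff_mem, Ideal.mem_span_pair] at h
  obtain ⟨a, b, hab⟩ := h
  refine ⟨Ideal.Quotient.mk _ a, Ideal.Quotient.mk _ b, ?_⟩
  rw [truncatedS, truncatedX, ← map_mul, ← map_mul, ← map_add]
  congr 1
  refine Polynomial.isRegular_X.left ?_
  change Polynomial.X * p = Polynomial.X * _
  rw [← hab]
  ring

theorem span_truncatedS_truncatedX_ne_top [Nontrivial A] :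
    Ideal.span {truncatedS A, truncatedX A} ≠ ⊤ := by
  intro h
  have hle : Ideal.span {truncatedS A, truncatedX A} ≤
      RingHom.ker ((RingHom.snd A A).comp (truncatedEval A)) := by
    rw [Ideal.span_le]
    rintro _ (rfl | rfl) <;>
      simp [RingHom.mem_ker, truncatedS, truncatedX, truncatedEval_mk]
  rw [h, top_le_iff] at hle
  exact RingHom.ker_ne_top _ hle

/-- The inclusion of the first factor `A` into `R`. -/
noncomputable def truncatedInl : A →ₙ+* TruncatedRing A where
  toFun a := Ideal.Quotient.mk _ (Polynomial.C (a, 0))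
  map_zero' := by rw [Prod.mk_zero_zero, map_zero, map_zero]
  map_add' a b := by rw [← map_add, ← map_add, Prod.mk_add_mk, add_zero]
  map_mul' a b := by rw [← map_mul, ← map_mul, Prod.mk_mul_mk, mul_zero]

/-- Since `s x = 0`, multiplication by `s` retains only the constant term. -/
theorem truncatedInl_truncatedEval (r : TruncatedRing A) :
    truncatedInl A (truncatedEval A r).1 = truncatedInl A 1 * r := by
  obtain ⟨p, rfl⟩ := Ideal.Quotient.mk_surjective r
  change Ideal.Quotient.mk _ (Polynomial.C ((p.eval 0).1, 0)) = truncatedS A * _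
  obtain ⟨q, hq⟩ : ∃ q, p = Polynomial.C (p.eval 0) + Polynomial.X * q := by
    refine ⟨p.divX, ?_⟩
    rw [← Polynomial.coeff_zero_eq_eval_zero, add_comm, Polynomial.X_mul_divX_add]
  have hmul {B : Type u} [CommRing B] (a b c d : B) (h : a * b = 0) :
      a * (c + b * d) = a * c := by
    linear_combination d * h
  have hmk : truncatedS A * Ideal.Quotient.mk _ p =
      truncatedS A * Ideal.Quotient.mk _ (Polynomial.C (p.eval 0)) := by
    conv_lhs => rw [hq, RingHom.map_add, RingHom.map_mul]
    exact hmul (B := TruncatedRing A) _ _ _ _ (truncatedS_mul_truncatedX A)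
  rw [hmk, truncatedS, ← RingHom.map_mul, ← RingHom.map_mul]
  congr 2
  ext <;> simp

theorem nontrivial_of_weakGlobalDim_ne_zero (h : weakGlobalDim A ≠ 0) : Nontrivial A := by
  by_contra hA
  rw [not_nontrivial_iff_subsingleton] at hA
  refine h (nonpos_iff_eq_zero.1 (iSup_le fun M ↦ ?_))
  have : Subsingleton M := Module.subsingleton A M
  have : Module.Flat A M := inferInstance
  simpa using flatDim_le (hasFlatResolution_zero (R := A) M)

end TruncatedRing

theorem mainTheorem12 (A : Type*) [CommRing A] (hA : weakGlobalDim A = 1) :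
    sWeakGlobalDim (R := TruncatedRing A) (truncatedSubmonoid A) = 1 ∧ weakGlobalDim (TruncatedRing A) = ⊤ := by
  constructor
  · let : Algebra (TruncatedRing A) A := ((RingHom.fst A A).comp (truncatedEval A)).toAlgebra
    refine sWeakGlobalDim_eq_weakGlobalDim (σ := truncatedInl A) (A := A) (fun a ↦ ?_)
      (truncatedInl_truncatedEval A) ?_ (Or.inr rfl) hA
    · change (truncatedEval A (Ideal.Quotient.mk _ (Polynomial.C (a, 0)))).1 = a
      simp [truncatedEval_mk]
    · rintro r (rfl | rfl)
      · exact map_one _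
      · change (truncatedEval A (Ideal.Quotient.mk _ (Polynomial.C (1, 0)))).1 = 1
        simp [truncatedEval_mk]
  · have := nontrivial_of_weakGlobalDim_ne_zero A (by simp [hA])
    exact weakGlobalDim_eq_top (truncatedS_mul_self A) (truncatedS_mul_truncatedX A)
      (truncatedX_mul_self A) (exists_of_truncatedX_mul_eq_zero A)
      (span_truncatedS_truncatedX_ne_top A)
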